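/- Let $V$, $V'$ be finite-dimensional real vector spaces. A convex cone is a convex set that is invariant under multiplication by positive scalars; an open convex cone $C$ is called proper if $\overline{C}\cap(-\overline{C})=\{0\}$. For a convex cone $C$ write $x\le_C y$ if $y-x\in\overline{C}$, and define the gauge $$M_C(x,y)=\inf\{\lambda>0 : x\le_C\lambda y\}\qquad (x,y\in C)$$ and, when $C$ is a proper open convex cone, Thompson's metric $$d_C(x,y)=\log\max\big(M_C(x,y),M_C(y,x)\big)\qquad (x,y\in C)$$ (with $d_C=0$ in the trivial case $C=\{0\}$). A map $\psi\colon D\to D'$ between convex cones is gauge-preserving if $M_{D'}(\psi x,\psi y)=M_D(x,y)$ for all $x,y\in D$, and gauge-reversing if $M_{D'}(\psi x,\psi y)=M_D(y,x)$ for all $x,y\in D$. For non-empty convex cones $C_1,C_2$ in $V$, write $C=C_1\oplus C_2$ if $C=C_1+C_2$ and $\operatorname{lin}C_1\cap\operatorname{lin}C_2=\{0\}$, where $\operatorname{lin}$ denotes the linear span; one of the factors is allowed to be $\{0\}$. Theorem. Let $C\subset V$ and $C'\subset V'$ be proper open convex cones, and let $\phi\colon C\to C'$ be a surjective isometry of the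 Thompson metrics, that is, $\phi$ is surjective and $d_{C'}(\phi(x),\phi(y))=d_C(x,y)$ for all $x,y\in C$. Then there exist non-empty convex cones $C_1,C_2\subset V$ and $C_1',C_2'\subset V'$ with $C=C_1\oplus C_2$ and $C'=C'_1\oplus C'_2$, a gauge-preserving map $\phi_1\colon C_1\to C_1'$, and a gauge-reversing map $\phi_2\colon C_2\to C_2'$, such that $$\phi(x_1+x_2)=\phi_1(x_1)+\phi_2(x_2)\qquad\text{for all }x_1\in C_1,\ x_2\in C_2.$$ -/

import Mathlib

open scoped Pointwise

namespace ConvexCone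

/-- `C` (a convex set closed under multiplication by positive scalars) is a *proper open* convex
cone: it is open and its closure contains no line. The second condition forces `C` to be
non-empty. -/
structure IsProperOpen {V : Type*} [NormedAddCommGroup V] [NormedSpace ℝ V]
    (C : ConvexCone ℝ V) : Prop where
  isOpen : IsOpen (C : Set V)
  closure_inter_neg : closure (C : Set V) ∩ -closure (C : Set V) = {0}

/-- The order induced by a convex cone `C`: `x ≤_C y` iff `y - x` lies in the closure of `C`.
(In finite dimension the closure in `V` is also the closure in the linear span of `C`, so this is
the intended order for cones that are only open in their span.) -/
def coneLE {V : Type*} [NormedAddCommGroup V] [NormedSpace ℝ V]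
    (C : ConvexCone ℝ V) (x y : V) : Prop :=
  y - x ∈ closure (C : Set V)

/-- The gauge `M_C(x, y) = inf {t > 0 | x ≤_C t y}`. -/
noncomputable def coneGauge {V : Type*} [NormedAddCommGroup V] [NormedSpace ℝ V]
    (C : ConvexCone ℝ V) (x y : V) : ℝ :=
  sInf {t : ℝ | 0 < t ∧ C.coneLE x (t • y)}

/-- Thompson's metric `log max (M_C(x, y), M_C(y, x))`. -/
noncomputable def thompsonDist {V : Type*} [NormedAddCommGroup V] [NormedSpace ℝ V]
    (C : ConvexCone ℝ V) (x y : V) : ℝ :=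
  Real.log (max (C.coneGauge x y) (C.coneGauge y x))

/-- `φ : C → C'` preserves the gauge. -/
def IsGaugePreserving {V V' : Type*} [NormedAddCommGroup V] [NormedSpace ℝ V]
    [NormedAddCommGroup V'] [NormedSpace ℝ V']
    {C : ConvexCone ℝ V} {C' : ConvexCone ℝ V'} (φ : C → C') : Prop :=
  ∀ x y : C, C'.coneGauge (φ x : V') (φ y : V') = C.coneGauge (x : V) (y : V)

/-- `φ : C → C'` reverses the gauge. -/
def IsGaugeReversing {V V' : Type*} [NormedAddCommGroup V] [NormedSpace ℝ V]
    [NormedAddCommGroup V'] [NormedSpace ℝ V']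
    {C : ConvexCone ℝ V} {C' : ConvexCone ℝ V'} (φ : C → C') : Prop :=
  ∀ x y : C, C'.coneGauge (φ x : V') (φ y : V') = C.coneGauge (y : V) (x : V)

/-- `φ : C → C'` preserves Thompson's metric. -/
def IsThompsonIsometry {V V' : Type*} [NormedAddCommGroup V] [NormedSpace ℝ V]
    [NormedAddCommGroup V'] [NormedSpace ℝ V']
    {C : ConvexCone ℝ V} {C' : ConvexCone ℝ V'} (φ : C → C') : Prop :=
  ∀ x y : C, C'.thompsonDist (φ x : V') (φ y : V') = C.thompsonDist (x : V) (y : V)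

/-- `C` is the direct product of the non-empty convex cones `C₁` and `C₂`: `C = C₁ + C₂`, and the
linear spans of `C₁` and `C₂` meet only in `0`. -/
structure IsDirectProduct {V : Type*} [NormedAddCommGroup V] [NormedSpace ℝ V]
    (C C₁ C₂ : ConvexCone ℝ V) : Prop where
  nonempty_left : (C₁ : Set V).Nonempty
  nonempty_right : (C₂ : Set V).Nonempty
  eq_add : (C : Set V) = (C₁ : Set V) + (C₂ : Set V)
  span_inf_span : Submodule.span ℝ (C₁ : Set V) ⊓ Submodule.span ℝ (C₂ : Set V) = ⊥

end ConvexCone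

/-! An isometry transports the functions x ↦ c · max(M(x,w), M(w,x)), and therefore their pointwise
limits. Every limit is max(A, B), where A is a limit of multiples of M(·,w), hence monotone,
subadditive and of degree 1, and B is a limit of multiples of M(w,·), hence antitone and of degree
-1. A functional f whose kernel is tangent to the cone at a boundary point with half-space tangent
cone is such a limit, and it is minimal: any limit below f is a multiple of f
(`IsSmoothFunctional.eq_const_mul_of_le`). Writing f ∘ φ = max(A, B) and noting that B is again a
limit, minimality forces f ∘ φ to be purely of degree 1 or purely of degree -1
(`PreservesMaxGauge.comp_smooth_functional`).

These functionals cut out the closed cone (`IsProperOpen.mem_closure_iff_smooth`), so the two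
classes split the target: the common kernels of the classes meet in 0, and both components of φ(x)
are combinations of φ(x) and φ(2x). The inverse map splits the source. Finally, scaling φ(x) by r
scales the two components of x by r and r⁻¹; a suitable r makes the comparison of one component
automatic, so that a comparison of the other component alone passes through φ. -/

namespace ConvexCone

open Filter Topology

/-! ### Open cones and their gauges -/

section Basic

variable {V : Type*} [NormedAddCommGroup V] [NormedSpace ℝ V] {C : ConvexCone ℝ V}

lemma add_mem_closure {x y : V} (hx : x ∈ closure (C : Set V)) (hy : y ∈ closure (C : Set V)) :
    x + y ∈ closure (C : Set V) :=
  C.closure.add_mem hx hy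

lemma IsProperOpen.zero_mem_closure (hC : C.IsProperOpen) : (0 : V) ∈ closure (C : Set V) := by
  have h : (0 : V) ∈ closure (C : Set V) ∩ -closure (C : Set V) := by
    rw [hC.closure_inter_neg]; rfl
  exact h.1

lemma IsProperOpen.nonempty (hC : C.IsProperOpen) : (C : Set V).Nonempty :=
  closure_nonempty_iff.1 ⟨0, hC.zero_mem_closure⟩

lemma IsProperOpen.smul_mem_closure (hC : C.IsProperOpen) {t : ℝ} (ht : 0 ≤ t) {x : V}
    (hx : x ∈ closure (C : Set V)) : t • x ∈ closure (C : Set V) := by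
  rcases ht.eq_or_lt with rfl | ht
  · rw [zero_smul]; exact hC.zero_mem_closure
  · exact C.closure.smul_mem ht hx

lemma IsProperOpen.eq_zero_of_neg_mem (hC : C.IsProperOpen) {x : V}
    (hx : x ∈ closure (C : Set V)) (hx' : -x ∈ closure (C : Set V)) : x = 0 := by
  have h : x ∈ closure (C : Set V) ∩ -closure (C : Set V) := ⟨hx, hx'⟩
  rwa [hC.closure_inter_neg] at h

lemma add_mem_of_mem_closure (hC : IsOpen (C : Set V)) {x y : V} (hx : x ∈ C)
    (hy : y ∈ closure (C : Set V)) : x + y ∈ C := by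
  have h : x + y ∈ (C : Set V) + closure (C : Set V) := Set.add_mem_add hx hy
  rw [hC.add_closure] at h
  obtain ⟨a, ha, b, hb, hab⟩ := h
  rw [← hab]
  exact C.add_mem ha hb

lemma exists_sub_smul_mem (hC : IsOpen (C : Set V)) {w : V} (hw : w ∈ C) (x : V) :
    ∃ t : ℝ, 0 < t ∧ w - t • x ∈ C := by
  have h : Tendsto (fun t : ℝ => w - t • x) (𝓝[>] 0) (𝓝 w) := by
    have : Tendsto (fun t : ℝ => w - t • x) (𝓝 0) (𝓝 (w - (0 : ℝ) • x)) :=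
      Continuous.tendsto (by fun_prop) 0
    rw [zero_smul, sub_zero] at this
    exact this.mono_left nhdsWithin_le_nhds
  obtain ⟨t, ht, ht'⟩ := ((h.eventually (hC.mem_nhds hw)).and self_mem_nhdsWithin).exists
  exact ⟨t, ht', ht⟩

lemma exists_smul_sub_mem (hC : IsOpen (C : Set V)) {w : V} (hw : w ∈ C) (x : V) :
    ∃ t : ℝ, 0 < t ∧ t • w - x ∈ C := by
  obtain ⟨t, ht, h⟩ := exists_sub_smul_mem hC hw x
  refine ⟨t⁻¹, inv_pos.2 ht, ?_⟩
  have := C.smul_mem (inv_pos.2 ht) h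
  rwa [smul_sub, smul_smul, inv_mul_cancel₀ ht.ne', one_smul] at this

lemma coneGauge_nonneg (x y : V) : 0 ≤ C.coneGauge x y :=
  Real.sInf_nonneg fun _ ht => ht.1.le

/-- The admissible t form an upward closed set whose defining condition is closed, so the infimum
satisfies it. The value t = 0 is included, although the definition of the gauge asks for positive t.
-/
lemma IsProperOpen.coneGauge_le_iff (hC : C.IsProperOpen) {x w : V} (hw : w ∈ C) {t : ℝ}
    (ht : 0 ≤ t) : C.coneGauge x w ≤ t ↔ t • w - x ∈ closure (C : Set V) := by
  have hbdd : BddBelow {t : ℝ | 0 < t ∧ C.coneLE x (t • w)} := ⟨0, fun _ h => h.1.le⟩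
  have hup : ∀ s u : ℝ, s ≤ u → s • w - x ∈ closure (C : Set V) →
      u • w - x ∈ closure (C : Set V) := fun s u hsu hs => by
    have := add_mem_closure hs (hC.smul_mem_closure (sub_nonneg.2 hsu) (subset_closure hw))
    rwa [sub_smul, sub_add_sub_comm, add_comm x, add_sub_add_comm, sub_self, zero_add] at this
  constructor
  · intro h
    have hmem : ∀ u : ℝ, t < u → u • w - x ∈ closure (C : Set V) := fun u hu => by
      have hne : {t : ℝ | 0 < t ∧ C.coneLE x (t • w)}.Nonempty := by
        obtain ⟨s, hs, hs'⟩ := exists_smul_sub_mem hC.isOpen hw x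
        exact ⟨s, hs, subset_closure hs'⟩
      obtain ⟨s, hs, hsu⟩ := exists_lt_of_csInf_lt hne (lt_of_le_of_lt h hu)
      exact hup s u hsu.le hs.2
    have hlim : Tendsto (fun u : ℝ => u • w - x) (𝓝[>] t) (𝓝 (t • w - x)) :=
      (Continuous.tendsto (by fun_prop) t).mono_left nhdsWithin_le_nhds
    exact isClosed_closure.mem_of_tendsto hlim
      (eventually_nhdsWithin_of_forall fun u hu => hmem u hu)
  · intro h
    refine le_of_forall_gt_imp_ge_of_dense fun u hu => ?_
    exact csInf_le hbdd ⟨ht.trans_lt hu, hup t u hu.le h⟩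

lemma IsProperOpen.coneGauge_smul_sub_mem (hC : C.IsProperOpen) {x w : V} (hw : w ∈ C) :
    C.coneGauge x w • w - x ∈ closure (C : Set V) :=
  (hC.coneGauge_le_iff hw (coneGauge_nonneg _ _)).1 le_rfl

/-- Openness at 0 would make `C` the whole space. In the zero space `C` = {0} is proper and open. -/
lemma IsProperOpen.zero_notMem [Nontrivial V] (hC : C.IsProperOpen) : (0 : V) ∉ C := by
  intro h0
  obtain ⟨v, hv⟩ := exists_ne (0 : V)
  have key : ∀ u : V, -u ∈ closure (C : Set V) := fun u => by
    obtain ⟨t, _, ht⟩ := exists_smul_sub_mem hC.isOpen h0 u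
    rw [smul_zero, zero_sub] at ht
    exact subset_closure ht
  exact hv (hC.eq_zero_of_neg_mem (by simpa using key (-v)) (key v))

lemma IsProperOpen.coneGauge_pos [Nontrivial V] (hC : C.IsProperOpen) {x w : V} (hx : x ∈ C)
    (hw : w ∈ C) : 0 < C.coneGauge x w := by
  refine lt_of_not_ge fun h => ?_
  rw [hC.coneGauge_le_iff hw le_rfl, zero_smul, zero_sub] at h
  exact hC.zero_notMem (hC.eq_zero_of_neg_mem (subset_closure hx) h ▸ hx)

end Basic

/-! ### Functionals tangent at smooth boundary points -/

section SmoothFunctional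

/-- `f` is a positive functional whose kernel is the tangent hyperplane of `C` at a boundary point
`p` where the tangent cone of `C` is a half-space. -/
structure IsSmoothFunctional {V : Type*} [NormedAddCommGroup V] [NormedSpace ℝ V]
    (C : ConvexCone ℝ V) (f : V →L[ℝ] ℝ) : Prop where
  pos : ∀ x ∈ C, 0 < f x
  exists_tangent : ∃ p ∈ closure (C : Set V), f p = 0 ∧
    ∀ v, 0 < f v → ∃ t : ℝ, 0 ≤ t ∧ v + t • p ∈ closure (C : Set V)

lemma IsSmoothFunctional.nonneg {V : Type*} [NormedAddCommGroup V] [NormedSpace ℝ V]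
    {C : ConvexCone ℝ V} {f : V →L[ℝ] ℝ} (hf : C.IsSmoothFunctional f) {x : V}
    (hx : x ∈ closure (C : Set V)) : 0 ≤ f x :=
  closure_minimal (fun y hy => (hf.pos y hy).le) (isClosed_Ici.preimage f.continuous) hx

/-- A functional minimised over a closed ball at `b` is negative in the direction `b - e`. -/
lemma inner_sub_neg_of_forall_closedBall {E : Type*} [NormedAddCommGroup E]
    [InnerProductSpace ℝ E] {a b e v : E} {ρ : ℝ} (hρ : 0 < ρ) (hb : b ∈ Metric.closedBall e ρ)
    (hmin : ∀ b' ∈ Metric.closedBall e ρ, inner ℝ a b ≤ inner ℝ a b') (hv : 0 < inner ℝ a v) :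
    inner ℝ (b - e) v < 0 := by
  have ha : 0 < ‖a‖ := by
    rw [norm_pos_iff]; rintro rfl; simp at hv
  set n : E := (ρ / ‖a‖) • a with hn
  have hnn : ‖n‖ = ρ := by
    rw [hn, norm_smul, Real.norm_of_nonneg (by positivity), div_mul_cancel₀ _ ha.ne']
  have h1 := hmin (e - n) (by simp [hnn])
  rw [Metric.mem_closedBall, dist_eq_norm] at hb
  have h2 : inner ℝ a n = ρ * ‖a‖ := by
    rw [hn, inner_smul_right, real_inner_self_eq_norm_sq]; field_simp
  have h3 : inner ℝ (b - e) n ≤ - ρ ^ 2 := by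
    have h4 : inner ℝ a (b - e) ≤ - (ρ * ‖a‖) := by
      rw [inner_sub_right] at h1 ⊢; linarith
    have h5 : inner ℝ (b - e) n = ρ / ‖a‖ * inner ℝ a (b - e) := by
      rw [hn, inner_smul_right, real_inner_comm]
    rw [h5]
    calc ρ / ‖a‖ * inner ℝ a (b - e) ≤ ρ / ‖a‖ * -(ρ * ‖a‖) := by gcongr
      _ = - ρ ^ 2 := by field_simp
  have h6 : ‖(b - e) + n‖ ^ 2 ≤ 0 := by
    rw [norm_add_sq_real, hnn]
    have : ‖b - e‖ ^ 2 ≤ ρ ^ 2 := by gcongr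
    linarith
  have h7 : (b - e) + n = 0 := by
    rw [← norm_eq_zero]; exact pow_eq_zero_iff (two_ne_zero) |>.1 (le_antisymm h6 (by positivity))
  rw [eq_neg_of_add_eq_zero_left h7, inner_neg_left, hn, real_inner_smul_left]
  have : 0 < ρ / ‖a‖ * inner ℝ a v := by positivity
  linarith

/-- The squared distance to e has derivative 2⟨b - e, v⟩ < 0 along v, so a short step stays in the
ball even from its boundary. -/
lemma exists_add_smul_mem_closedBall {E : Type*} [NormedAddCommGroup E]
    [InnerProductSpace ℝ E] {b e v : E} {ρ : ℝ} (hb : b ∈ Metric.closedBall e ρ)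
    (hv : inner ℝ (b - e) v < 0) : ∃ s : ℝ, 0 < s ∧ b + s • v ∈ Metric.closedBall e ρ := by
  rw [Metric.mem_closedBall, dist_eq_norm] at hb
  have hlim : Tendsto (fun s : ℝ => 2 * inner ℝ (b - e) v + s * ‖v‖ ^ 2) (𝓝[>] 0)
      (𝓝 (2 * inner ℝ (b - e) v + 0 * ‖v‖ ^ 2)) :=
    (Continuous.tendsto (by fun_prop) 0).mono_left nhdsWithin_le_nhds
  obtain ⟨s, hs, hs'⟩ :=
    ((hlim.eventually (gt_mem_nhds (by linarith : _ < (0 : ℝ)))).and self_mem_nhdsWithin).exists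
  replace hs' : 0 < s := hs'
  refine ⟨s, hs', ?_⟩
  rw [Metric.mem_closedBall, dist_eq_norm]
  have h1 : ‖b + s • v - e‖ ^ 2 ≤ ‖b - e‖ ^ 2 := by
    have : b + s • v - e = (b - e) + s • v := by abel
    rw [this, norm_add_sq_real, inner_smul_right, norm_smul, Real.norm_of_nonneg hs'.le]
    nlinarith
  exact (abs_le_of_sq_le_sq' h1 (norm_nonneg _)).2.trans hb

/-- Take the smallest homothetic copy, with centre y, of a ball in `C` that still lies in the
closure. Where it touches the boundary, the supporting hyperplane of `C` is tangent to the ball, so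
the tangent cone is a half-space, and y is strictly beyond the hyperplane. -/
lemma exists_smooth_functional_of_inner {E : Type*} [NormedAddCommGroup E]
    [InnerProductSpace ℝ E] [FiniteDimensional ℝ E] {C : ConvexCone ℝ E}
    (hC : IsOpen (C : Set E)) (hne : (C : Set E).Nonempty) {y : E}
    (hy : y ∉ closure (C : Set E)) : ∃ f, C.IsSmoothFunctional f ∧ f y < 0 := by
  obtain ⟨e, he⟩ := hne
  obtain ⟨ρ, hρ, hball⟩ := Metric.nhds_basis_closedBall.mem_iff.1 (hC.mem_nhds he)
  set P : ℝ → E → E := fun s b => (1 - s) • y + s • b with hP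
  have hPc : Continuous fun q : ℝ × E => P q.1 q.2 := by simp only [hP]; fun_prop
  set S : Set ℝ := {s | 0 ≤ s ∧ ∀ b ∈ Metric.closedBall e ρ, P s b ∈ closure (C : Set E)} with hS
  have hSc : IsClosed S := by
    simp only [hS, Set.ofPred_and, Set.ofPred_forall]
    refine isClosed_Ici.inter (isClosed_iInter fun b => isClosed_iInter fun _ => ?_)
    exact isClosed_closure.preimage (f := fun s => P s b) (by simp only [hP]; fun_prop)
  have h1S : (1 : ℝ) ∈ S := ⟨zero_le_one, fun b hb => by
    simp only [hP, sub_self, zero_smul, zero_add, one_smul]; exact subset_closure (hball hb)⟩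
  have hSb : BddBelow S := ⟨0, fun s hs => hs.1⟩
  set s := sInf S with hs
  have hsS : s ∈ S := hSc.csInf_mem ⟨1, h1S⟩ hSb
  have hs0 : 0 < s := by
    refine lt_of_le_of_ne hsS.1 fun h => hy ?_
    have := hsS.2 e (Metric.mem_closedBall_self hρ.le)
    simpa [hP, ← h] using this
  -- If the whole copy lay in the open cone, compactness of the ball would allow a smaller ratio.
  obtain ⟨b, hb, hbC⟩ : ∃ b ∈ Metric.closedBall e ρ, P s b ∉ C := by
    by_contra! hcon
    have hev : ∀ᶠ u in 𝓝 s, ∀ b ∈ Metric.closedBall e ρ, P u b ∈ (C : Set E) :=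
      (isCompact_closedBall e ρ).eventually_forall_of_forall_eventually fun b hb =>
        hPc.continuousAt.eventually (hC.mem_nhds (hcon b hb))
    obtain ⟨u, ⟨hu, hu0⟩, hus⟩ := (((hev.and (lt_mem_nhds hs0)).filter_mono
      nhdsWithin_le_nhds).and (self_mem_nhdsWithin : Set.Iio s ∈ 𝓝[<] s)).exists
    exact absurd (csInf_le hSb ⟨hu0.le, fun b hb => subset_closure (hu b hb)⟩) (not_le.2 hus)
  have hs1 : s ≤ 1 := csInf_le hSb h1S
  set p := P s b with hp
  have hpK : p ∈ closure (C : Set E) := hsS.2 b hb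
  obtain ⟨g, hg⟩ := geometric_hahn_banach_open_point C.convex hC hbC
  have hg0 : ∀ a ∈ C, g a ≤ 0 := fun a ha => by
    by_contra! hga
    obtain ⟨n, hn⟩ := exists_nat_gt (g p / g a)
    have hn' : (0 : ℝ) < n + 1 := by positivity
    have h1 := hg _ (C.smul_mem hn' ha)
    rw [map_smul, smul_eq_mul] at h1
    rw [div_lt_iff₀ hga] at hn
    linarith
  have hgK : ∀ a ∈ closure (C : Set E), g a ≤ 0 := fun a ha =>
    closure_minimal (fun a ha => hg0 a ha) (isClosed_Iic.preimage g.continuous) ha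
  have hgp : g p = 0 := by
    refine le_antisymm (hgK p hpK) ?_
    have hlim : Tendsto (fun t : ℝ => g (t • e)) (𝓝[>] 0) (𝓝 (g ((0 : ℝ) • e))) :=
      (Continuous.tendsto (by fun_prop) 0).mono_left nhdsWithin_le_nhds
    rw [zero_smul, map_zero] at hlim
    exact le_of_tendsto hlim
      (eventually_nhdsWithin_of_forall fun t ht => (hg _ (C.smul_mem ht he)).le)
  have hpos : ∀ a ∈ C, 0 < -g a := fun a ha => by linarith [hg a ha]
  have hgP : ∀ b', g (P s b') = (1 - s) * g y + s * g b' := fun b' => by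
    simp only [hP, map_add, map_smul, smul_eq_mul]
  have hgb := hpos b (hball hb)
  refine ⟨-g, ⟨fun x hx => by simpa using hpos x hx, p, hpK, by simp [hgp], fun v hv => ?_⟩, ?_⟩
  · have hrep : ∀ u, inner ℝ ((InnerProductSpace.toDual ℝ E).symm (-g)) u = (-g) u := fun u => by
      rw [InnerProductSpace.toDual_symm_apply]
    have hneg : inner ℝ (b - e) v < 0 := by
      refine inner_sub_neg_of_forall_closedBall
        (a := (InnerProductSpace.toDual ℝ E).symm (-g)) hρ hb (fun b' hb' => ?_) (by rwa [hrep])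
      rw [hrep, hrep, _root_.neg_apply, _root_.neg_apply]
      have h1 := hgK _ (hsS.2 b' hb')
      have h2 := hgp
      rw [hp, hgP] at h2
      rw [hgP] at h1
      have : s * g b' ≤ s * g b := by linarith
      linarith [le_of_mul_le_mul_left this hs0]
    -- A step r from b along v stays in the ball, so p + s r v is in the closure; dividing by s r
    -- gives v + t p.
    obtain ⟨r, hr, hrb⟩ := exists_add_smul_mem_closedBall hb hneg
    have h1 := C.closure.smul_mem (inv_pos.2 (mul_pos hs0 hr)) (hsS.2 _ hrb)
    refine ⟨(s * r)⁻¹, by positivity, ?_⟩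
    have h2 : v + (s * r)⁻¹ • p = (s * r)⁻¹ • P s (b + r • v) := by
      have : P s (b + r • v) = p + (s * r) • v := by
        simp only [hp, hP, smul_add, smul_smul, add_assoc]
      rw [this, smul_add _ p, smul_smul, inv_mul_cancel₀ (by positivity), one_smul, add_comm]
    rw [h2]; exact h1
  · rw [hp, hgP] at hgp
    rw [_root_.neg_apply]
    have h1 : 0 < (1 - s) * g y := by nlinarith
    have h2 : 0 ≤ 1 - s := by linarith
    linarith [pos_of_mul_pos_right h1 h2]

/-- Smoothness of a functional is invariant under linear homeomorphisms, so a Euclidean model can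
supply the inner product. -/
theorem IsProperOpen.exists_smooth_functional {V : Type*} [NormedAddCommGroup V]
    [NormedSpace ℝ V] [FiniteDimensional ℝ V] {C : ConvexCone ℝ V} (hC : C.IsProperOpen) {y : V}
    (hy : y ∉ closure (C : Set V)) : ∃ f, C.IsSmoothFunctional f ∧ f y < 0 := by
  set T := toEuclidean (E := V)
  set D := C.map T.toLinearEquiv.toLinearMap with hD
  have hDs : (D : Set _) = T '' C := rfl
  have hcl : closure (D : Set _) = T '' closure (C : Set V) := by
    rw [hDs, T.image_closure]
  obtain ⟨f, hf, hfy⟩ := exists_smooth_functional_of_inner (C := D)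
    (by rw [hDs]; exact T.toHomeomorph.isOpenMap _ hC.isOpen)
    (by rw [hDs]; exact hC.nonempty.image _) (y := T y)
    (by rw [hcl]; rintro ⟨z, hz, hzy⟩; exact hy (T.injective hzy ▸ hz))
  obtain ⟨p, hp, hfp, ht⟩ := hf.exists_tangent
  rw [hcl] at hp
  obtain ⟨q, hq, rfl⟩ := hp
  refine ⟨f.comp (T : V →L[ℝ] EuclideanSpace ℝ (Fin (Module.finrank ℝ V))),
    ⟨fun x hx => hf.pos _ ⟨x, hx, rfl⟩, q, hq, hfp, fun v hv => ?_⟩, hfy⟩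
  obtain ⟨t, ht0, htm⟩ := ht (T v) hv
  rw [hcl] at htm
  obtain ⟨z, hz, hzv⟩ := htm
  refine ⟨t, ht0, ?_⟩
  have : z = v + t • q := T.injective (by rw [hzv, map_add, map_smul])
  exact this ▸ hz

/-- This lets every order relation be tested on smooth functionals only. -/
lemma IsProperOpen.mem_closure_iff_smooth {V : Type*} [NormedAddCommGroup V]
    [NormedSpace ℝ V] [FiniteDimensional ℝ V] {C : ConvexCone ℝ V} (hC : C.IsProperOpen) {y : V} :
    y ∈ closure (C : Set V) ↔ ∀ f, C.IsSmoothFunctional f → 0 ≤ f y := by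
  refine ⟨fun hy f hf => hf.nonneg hy, fun h => ?_⟩
  by_contra hy
  obtain ⟨f, hf, hfy⟩ := hC.exists_smooth_functional hy
  exact absurd (h f hf) (not_le.2 hfy)

lemma IsProperOpen.eq_zero_of_smooth {V : Type*} [NormedAddCommGroup V]
    [NormedSpace ℝ V] [FiniteDimensional ℝ V] {C : ConvexCone ℝ V} (hC : C.IsProperOpen) {y : V}
    (h : ∀ f, C.IsSmoothFunctional f → f y = 0) : y = 0 :=
  hC.eq_zero_of_neg_mem (hC.mem_closure_iff_smooth.2 fun f hf => (h f hf).ge)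
    (hC.mem_closure_iff_smooth.2 fun f hf => by rw [map_neg, h f hf, neg_zero])

end SmoothFunctional

/-! ### Limits of distance functions and their minimal elements -/

section DistanceFunctions

variable {V : Type*} [NormedAddCommGroup V] [NormedSpace ℝ V] {C : ConvexCone ℝ V}

/-- `h` is monotone and homogeneous of degree `1` for the order of `C`. -/
def IsOrderHomogeneous (h : C → ℝ) : Prop :=
  ∀ (x y : C) (t : ℝ), 0 < t → t • (y : V) - x ∈ closure (C : Set V) → h x ≤ t * h y

/-- `h` is antitone and homogeneous of degree `-1` for the order of `C`. -/
def IsOrderAntihomogeneous (h : C → ℝ) : Prop :=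
  ∀ (x y : C) (t : ℝ), 0 < t → t • (y : V) - x ∈ closure (C : Set V) → h y ≤ t * h x

/-- The pointwise limits of multiples of the functions `x ↦ max (M(x, w)) (M(w, x))`. -/
def distanceLimits (C : ConvexCone ℝ V) : Set (C → ℝ) :=
  closure {h | ∃ (w : C) (c : ℝ), 0 < c ∧
    h = fun x : C => c * max (C.coneGauge x w) (C.coneGauge w x)}

lemma IsOrderHomogeneous.const_mul {h : C → ℝ} (hh : IsOrderHomogeneous h) {a : ℝ} (ha : 0 ≤ a) :
    IsOrderHomogeneous fun x => a * h x := fun x y t ht hxy => by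
  calc a * h x ≤ a * (t * h y) := by gcongr; exact hh x y t ht hxy
    _ = t * (a * h y) := by ring

lemma IsOrderAntihomogeneous.const_mul {h : C → ℝ} (hh : IsOrderAntihomogeneous h) {a : ℝ}
    (ha : 0 ≤ a) : IsOrderAntihomogeneous fun x => a * h x := fun x y t ht hxy => by
  calc a * h y ≤ a * (t * h x) := by gcongr; exact hh x y t ht hxy
    _ = t * (a * h x) := by ring

lemma IsProperOpen.isOrderHomogeneous_coneGauge (hC : C.IsProperOpen) {w : V} (hw : w ∈ C) :
    IsOrderHomogeneous fun x : C => C.coneGauge x w := fun x y t ht hxy => by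
  rw [hC.coneGauge_le_iff hw (mul_nonneg ht.le (coneGauge_nonneg _ _))]
  have := add_mem_closure (hC.smul_mem_closure ht.le (hC.coneGauge_smul_sub_mem (x := y) hw)) hxy
  rwa [smul_sub, smul_smul, sub_add_sub_cancel] at this

lemma IsProperOpen.isOrderAntihomogeneous_coneGauge (hC : C.IsProperOpen) (w : V) :
    IsOrderAntihomogeneous fun x : C => C.coneGauge w x := fun x y t ht hxy => by
  rw [hC.coneGauge_le_iff y.2 (mul_nonneg ht.le (coneGauge_nonneg _ _))]
  have := add_mem_closure (hC.smul_mem_closure (coneGauge_nonneg (C := C) w (x : V)) hxy)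
    (hC.coneGauge_smul_sub_mem (x := w) x.2)
  rwa [smul_sub, smul_smul, sub_add_sub_cancel, mul_comm] at this

lemma IsProperOpen.coneGauge_add_le (hC : C.IsProperOpen) {w : V} (hw : w ∈ C) (x y : V) :
    C.coneGauge (x + y) w ≤ C.coneGauge x w + C.coneGauge y w := by
  rw [hC.coneGauge_le_iff hw (add_nonneg (coneGauge_nonneg _ _) (coneGauge_nonneg _ _)), add_smul,
    add_sub_add_comm]
  exact add_mem_closure (hC.coneGauge_smul_sub_mem hw) (hC.coneGauge_smul_sub_mem hw)

lemma isClosed_isOrderHomogeneous : IsClosed {h : C → ℝ | IsOrderHomogeneous h} := by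
  simp only [IsOrderHomogeneous, Set.ofPred_forall]
  exact isClosed_iInter fun x => isClosed_iInter fun y => isClosed_iInter fun t =>
    isClosed_iInter fun _ => isClosed_iInter fun _ => isClosed_le (by fun_prop) (by fun_prop)

lemma isClosed_isOrderAntihomogeneous : IsClosed {h : C → ℝ | IsOrderAntihomogeneous h} := by
  simp only [IsOrderAntihomogeneous, Set.ofPred_forall]
  exact isClosed_iInter fun x => isClosed_iInter fun y => isClosed_iInter fun t =>
    isClosed_iInter fun _ => isClosed_iInter fun _ => isClosed_le (by fun_prop) (by fun_prop)

lemma mem_distanceLimits_of_tendsto {h : C → ℝ} (w : ℕ → C) (c : ℕ → ℝ) (hc : ∀ n, 0 < c n)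
    (hlim : ∀ x : C, Tendsto (fun n => c n * max (C.coneGauge x (w n)) (C.coneGauge (w n) x)) atTop
      (𝓝 (h x))) : h ∈ distanceLimits C :=
  mem_closure_of_tendsto (tendsto_pi_nhds.2 hlim)
    (Eventually.of_forall fun n => ⟨w n, c n, hc n, rfl⟩)

lemma tendsto_inv_natCast_succ : Tendsto (fun n : ℕ => ((n : ℝ) + 1)⁻¹) atTop (𝓝 0) := by
  simpa using tendsto_one_div_add_atTop_nhds_zero_nat (𝕜 := ℝ)

/-- Multiples of `M(r, ·)` are limits of distance functions. -/
lemma IsProperOpen.const_mul_coneGauge_mem_distanceLimits (hC : C.IsProperOpen) (r : C) {c : ℝ}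
    (hc : 0 < c) : (fun x : C => c * C.coneGauge r x) ∈ distanceLimits C := by
  have hpos : ∀ n : ℕ, (0 : ℝ) < n + 1 := fun n => by positivity
  -- Along w_n = (n + 1) r, M(w_n, x) grows like n + 1 while M(x, w_n) stays bounded; the weights c
  -- / (n + 1) kill the latter.
  refine mem_distanceLimits_of_tendsto
    (fun n => ⟨((n : ℝ) + 1) • (r : V), C.smul_mem (hpos n) r.2⟩) (fun n => c * ((n : ℝ) + 1)⁻¹)
    (fun n => mul_pos hc (inv_pos.2 (hpos n))) fun x => ?_
  have h1 : ∀ n : ℕ, C.coneGauge (((n : ℝ) + 1) • (r : V)) x = (n + 1) * C.coneGauge r x := by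
    intro n
    refine le_antisymm ?_ ?_
    · have := hC.isOrderHomogeneous_coneGauge x.2 ⟨((n : ℝ) + 1) • (r : V), C.smul_mem (hpos n) r.2⟩
        r (n + 1) (hpos n) (by rw [sub_self]; exact hC.zero_mem_closure)
      exact this
    · have := hC.isOrderHomogeneous_coneGauge x.2 r
        ⟨((n : ℝ) + 1) • (r : V), C.smul_mem (hpos n) r.2⟩ (n + 1)⁻¹ (inv_pos.2 (hpos n)) (by
          rw [smul_smul, inv_mul_cancel₀ (hpos n).ne', one_smul, sub_self]
          exact hC.zero_mem_closure)
      rwa [inv_mul_eq_div, le_div_iff₀' (hpos n)] at this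
  have h2 : ∀ n : ℕ, C.coneGauge x (((n : ℝ) + 1) • (r : V)) ≤ C.coneGauge x r := by
    intro n
    have := hC.isOrderAntihomogeneous_coneGauge x r
      ⟨((n : ℝ) + 1) • (r : V), C.smul_mem (hpos n) r.2⟩ 1 one_pos (by
        change (1 : ℝ) • (((n : ℝ) + 1) • (r : V)) - r ∈ _
        rw [one_smul, add_smul, one_smul, add_sub_cancel_right]
        exact hC.smul_mem_closure (by positivity) (subset_closure r.2))
    rwa [one_mul] at this
  have h3 : Tendsto (fun n : ℕ => c * ((n : ℝ) + 1)⁻¹ *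
      C.coneGauge x (((n : ℝ) + 1) • (r : V))) atTop (𝓝 0) := by
    have hlim : Tendsto (fun n : ℕ => c * ((n : ℝ) + 1)⁻¹ * C.coneGauge x r) atTop (𝓝 0) := by
      simpa using (tendsto_inv_natCast_succ.const_mul c).mul_const (C.coneGauge x r)
    refine squeeze_zero (fun n => ?_) (fun n => ?_) hlim
    · have := coneGauge_nonneg (C := C) x (((n : ℝ) + 1) • (r : V))
      have := hpos n
      positivity
    · have := hpos n
      gcongr
      exact h2 n
  have h4 := h3.max (tendsto_const_nhds (x := c * C.coneGauge r x))
  rw [max_eq_right (mul_nonneg hc.le (coneGauge_nonneg _ _))] at h4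
  refine h4.congr fun n => ?_
  have := hpos n
  rw [mul_max_of_nonneg _ _ (by positivity)]
  congr 1
  rw [h1]
  field_simp

/-- Smooth functionals are limits of distance functions. -/
lemma IsSmoothFunctional.mem_distanceLimits (hC : C.IsProperOpen) {f : V →L[ℝ] ℝ}
    (hf : C.IsSmoothFunctional f) : (fun x : C => f x) ∈ distanceLimits C := by
  obtain ⟨e, he⟩ := hC.nonempty
  have hfe := hf.pos e he
  obtain ⟨p, hp, hfp, htan⟩ := hf.exists_tangent
  have hpos : ∀ n : ℕ, (0 : ℝ) < n + 1 := fun n => by positivity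
  have hwC : ∀ n : ℕ, ((n : ℝ) + 1)⁻¹ • e + p ∈ C := fun n =>
    add_mem_of_mem_closure hC.isOpen (C.smul_mem (inv_pos.2 (hpos n)) he) hp
  -- The points w_n = e / (n + 1) + p tend to p and the weight is f(w_n). Since M(w_n, x) ≤ M(e + p,
  -- x), only M(x, w_n) survives in the limit.
  refine mem_distanceLimits_of_tendsto (fun n => ⟨_, hwC n⟩) (fun n => f e * ((n : ℝ) + 1)⁻¹)
    (fun n => mul_pos hfe (inv_pos.2 (hpos n))) fun x => ?_
  have h1 : Tendsto (fun n : ℕ => f e * ((n : ℝ) + 1)⁻¹ *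
      C.coneGauge x (((n : ℝ) + 1)⁻¹ • e + p)) atTop (𝓝 (f x)) := by
    rw [tendsto_order]
    constructor
    · intro a ha
      refine Eventually.of_forall fun n => ha.trans_le ?_
      have := hf.nonneg (hC.coneGauge_smul_sub_mem (x := (x : V)) (hwC n))
      rw [map_sub, map_smul, map_add, map_smul, hfp, smul_eq_mul, smul_eq_mul] at this
      linarith
    · intro a ha
      have ha0 : 0 < a := (hf.pos x x.2).trans ha
      obtain ⟨b, hb, hba⟩ := exists_between ha
      have hb0 : 0 < b := (hf.pos x x.2).trans hb
      -- As f x < b, tangency puts (b / f e) e - x + t p in the closure; for large n the coefficient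
      -- of p in (b (n + 1) / f e) w_n is at least t.
      obtain ⟨t, ht, htm⟩ := htan ((b / f e) • e - x) (by
        rw [map_sub, map_smul, smul_eq_mul, div_mul_cancel₀ _ hfe.ne']; linarith)
      obtain ⟨N, hN⟩ := exists_nat_gt (t * f e / b)
      filter_upwards [eventually_ge_atTop N] with n hn
      have hn' : t * f e / b ≤ n + 1 := by
        have : (N : ℝ) ≤ n := by exact_mod_cast hn
        linarith
      have h2 : C.coneGauge x (((n : ℝ) + 1)⁻¹ • e + p) ≤ b * (n + 1) / f e := by
        have := hpos n
        rw [hC.coneGauge_le_iff (hwC n) (by positivity)]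
        have h3 : b * (n + 1) / f e - t ≥ 0 := by
          rw [ge_iff_le, sub_nonneg, le_div_iff₀ hfe, mul_comm b]
          rwa [div_le_iff₀ hb0] at hn'
        have h4 := add_mem_closure htm (hC.smul_mem_closure h3 hp)
        have h5 : (b * (n + 1) / f e) • (((n : ℝ) + 1)⁻¹ • e + p) - x =
            (b / f e) • e - ↑x + t • p + (b * (n + 1) / f e - t) • p := by
          have : b * (n + 1) / f e * ((n : ℝ) + 1)⁻¹ = b / f e := by field_simp
          rw [smul_add, smul_smul, this]
          module
        rwa [h5]
      have := hpos n
      calc f e * ((n : ℝ) + 1)⁻¹ * C.coneGauge x (((n : ℝ) + 1)⁻¹ • e + p)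
          ≤ f e * ((n : ℝ) + 1)⁻¹ * (b * (n + 1) / f e) := by gcongr
        _ = b := by field_simp
        _ < a := hba
  have h2 : Tendsto (fun n : ℕ => f e * ((n : ℝ) + 1)⁻¹ *
      C.coneGauge (((n : ℝ) + 1)⁻¹ • e + p) x) atTop (𝓝 0) := by
    have hlim : Tendsto (fun n : ℕ => f e * ((n : ℝ) + 1)⁻¹ * C.coneGauge (e + p) x) atTop
        (𝓝 0) := by
      simpa using (tendsto_inv_natCast_succ.const_mul (f e)).mul_const (C.coneGauge (e + p) x)
    refine squeeze_zero (fun n => ?_) (fun n => ?_) hlim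
    · have := coneGauge_nonneg (C := C) (((n : ℝ) + 1)⁻¹ • e + p) x
      have := hpos n
      positivity
    · have := hpos n
      gcongr
      have := hC.isOrderHomogeneous_coneGauge x.2 ⟨_, hwC n⟩
        ⟨e + p, add_mem_of_mem_closure hC.isOpen he hp⟩ 1 one_pos (by
          have h3 : 0 ≤ 1 - ((n : ℝ) + 1)⁻¹ := sub_nonneg.2 (inv_le_one_of_one_le₀ (by simp))
          have h4 := hC.smul_mem_closure h3 (subset_closure he)
          have h5 : (1 : ℝ) • (e + p) - (((n : ℝ) + 1)⁻¹ • e + p) =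
            (1 - ((n : ℝ) + 1)⁻¹) • e := by module
          exact h5 ▸ h4)
      rwa [one_mul] at this
  have h3 := h1.max h2
  rw [max_eq_left (hf.pos x x.2).le] at h3
  refine h3.congr fun n => ?_
  have := hpos n
  rw [mul_max_of_nonneg _ _ (by positivity)]

/-- A limit of distance functions is the maximum of a homogeneous subadditive function and of an
antihomogeneous one, which is itself a limit of distance functions. -/
lemma IsProperOpen.exists_max_of_mem_distanceLimits (hC : C.IsProperOpen) {h : C → ℝ}
    (hh : h ∈ distanceLimits C) : ∃ A B : C → ℝ, (∀ x, h x = max (A x) (B x)) ∧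
      IsOrderHomogeneous A ∧ (∀ x y z : C, (z : V) = x + y → A z ≤ A x + A y) ∧ (∀ x, 0 ≤ A x) ∧
      IsOrderAntihomogeneous B ∧ (∀ x, 0 ≤ B x) ∧ B ∈ distanceLimits C := by
  obtain ⟨u, hu, hlim⟩ := mem_closure_iff_ultrafilter.1 hh
  -- Base points and weights are chosen for every F, with junk values off the family, so that both
  -- gauges become functions of F along `u`.
  have hex : ∀ F : C → ℝ, ∃ (w : C) (c : ℝ), 0 < c ∧
      ((∃ (w : C) (c : ℝ), 0 < c ∧
        F = fun x : C => c * max (C.coneGauge x w) (C.coneGauge w x)) →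
      F = fun x : C => c * max (C.coneGauge x w) (C.coneGauge w x)) := fun F => by
    by_cases hF : ∃ (w : C) (c : ℝ), 0 < c ∧
        F = fun x : C => c * max (C.coneGauge x w) (C.coneGauge w x)
    · obtain ⟨w, c, hc, hF'⟩ := hF
      exact ⟨w, c, hc, fun _ => hF'⟩
    · obtain ⟨e, he⟩ := hC.nonempty
      exact ⟨⟨e, he⟩, 1, one_pos, fun h => absurd h hF⟩
  choose w c hc hF using hex
  have hmax : ∀ x : C, Tendsto (fun F => max (c F * C.coneGauge x (w F))
      (c F * C.coneGauge (w F) x)) (u : Filter (C → ℝ)) (𝓝 (h x)) := fun x => by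
    have h1 : Tendsto (fun F : C → ℝ => F x) u (𝓝 (h x)) :=
      ((continuous_apply x).tendsto h).mono_left hlim
    refine h1.congr' ?_
    filter_upwards [hu] with F hFs
    rw [← mul_max_of_nonneg _ _ (hc F).le]
    exact congrFun (hF F hFs) x
  -- Both gauges are bounded by their convergent maximum, so along an ultrafilter each converges
  -- separately.
  have hconv : ∀ (G : (C → ℝ) → ℝ) (b : ℝ), (∀ F, 0 ≤ G F) → (∀ᶠ F in (u : Filter (C → ℝ)),
      G F ≤ b) → ∃ a, Tendsto G u (𝓝 a) := fun G b hG0 hGb => by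
    obtain ⟨a, _, ha⟩ := isCompact_Icc.ultrafilter_le_nhds' (u.map G)
      (show Set.Icc 0 b ∈ u.map G from by
        rw [Ultrafilter.mem_map]
        filter_upwards [hGb] with F hF'
        exact ⟨hG0 F, hF'⟩)
    exact ⟨a, ha⟩
  have hbd : ∀ x : C, ∀ᶠ F in (u : Filter (C → ℝ)), max (c F * C.coneGauge x (w F))
      (c F * C.coneGauge (w F) x) ≤ h x + 1 := fun x =>
    ((hmax x).eventually (gt_mem_nhds (lt_add_one _))).mono fun F h => h.le
  have hA : ∀ x : C, ∃ a, Tendsto (fun F => c F * C.coneGauge x (w F)) u (𝓝 a) := fun x =>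
    hconv _ (h x + 1) (fun F => mul_nonneg (hc F).le (coneGauge_nonneg _ _))
      ((hbd x).mono fun F h => (le_max_left _ _).trans h)
  have hB : ∀ x : C, ∃ a, Tendsto (fun F => c F * C.coneGauge (w F) x) u (𝓝 a) := fun x =>
    hconv _ (h x + 1) (fun F => mul_nonneg (hc F).le (coneGauge_nonneg _ _))
      ((hbd x).mono fun F h => (le_max_right _ _).trans h)
  choose A hA using hA
  choose B hB using hB
  refine ⟨A, B, fun x => tendsto_nhds_unique (hmax x) ((hA x).max (hB x)), ?_, ?_, ?_, ?_, ?_, ?_⟩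
  · exact isClosed_isOrderHomogeneous.mem_of_tendsto (tendsto_pi_nhds.2 hA)
      (Eventually.of_forall fun F =>
        (hC.isOrderHomogeneous_coneGauge (w F).2).const_mul (hc F).le)
  · intro x y z hz
    refine le_of_tendsto_of_tendsto' (hA z) ((hA x).add (hA y)) fun F => ?_
    rw [← mul_add, hz]
    exact mul_le_mul_of_nonneg_left (hC.coneGauge_add_le (w F).2 _ _) (hc F).le
  · exact fun x => ge_of_tendsto' (hA x) fun F => mul_nonneg (hc F).le (coneGauge_nonneg _ _)
  · exact isClosed_isOrderAntihomogeneous.mem_of_tendsto (tendsto_pi_nhds.2 hB)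
      (Eventually.of_forall fun F =>
        (hC.isOrderAntihomogeneous_coneGauge _).const_mul (hc F).le)
  · exact fun x => ge_of_tendsto' (hB x) fun F => mul_nonneg (hc F).le (coneGauge_nonneg _ _)
  · exact isClosed_closure.mem_of_tendsto (tendsto_pi_nhds.2 hB)
      (Eventually.of_forall fun F => hC.const_mul_coneGauge_mem_distanceLimits (w F) (hc F))

/-- A homogeneous subadditive function dominated by a smooth functional is a multiple of it. -/
lemma IsSmoothFunctional.mul_le_mul_of_le (hC : C.IsProperOpen) {f : V →L[ℝ] ℝ}
    (hf : C.IsSmoothFunctional f) {A : C → ℝ} (hA : IsOrderHomogeneous A)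
    (hsub : ∀ x y z : C, (z : V) = x + y → A z ≤ A x + A y) (hle : ∀ x, A x ≤ f x)
    (x y : C) : f y * A x ≤ f x * A y := by
  obtain ⟨p, hp, hfp, htan⟩ := hf.exists_tangent
  have hfy := hf.pos y y.2
  have hfx := hf.pos x x.2
  refine le_of_forall_pos_le_add fun η hη => ?_
  have hAy : 0 < |A y| + 1 := by positivity
  set ε := η / 2 / (|A y| + 1) with hε
  have hε0 : 0 < ε := by positivity
  -- On this vector f equals ε · f y > 0, so tangency applies. Since f p = 0, p is not in `C`; A is
  -- evaluated near p, at p + δ y, where f makes it small.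
  obtain ⟨t, ht, htm⟩ := htan ((f x + ε) • (y : V) - f y • (x : V)) (by
    rw [map_sub, map_smul, map_smul, smul_eq_mul, smul_eq_mul]
    nlinarith)
  set δ := η / 2 / (t * f y + 1) with hδ
  have hδ0 : 0 < δ := by positivity
  have hq : p + δ • (y : V) ∈ C := by
    rw [add_comm]
    exact add_mem_of_mem_closure hC.isOpen (C.smul_mem hδ0 y.2) hp
  -- For t = 0 the point t (p + δ y) need not lie in `C`.
  rcases ht.eq_or_lt with rfl | ht0
  · rw [zero_smul, add_zero] at htm
    have h1 := hA x y ((f x + ε) / f y) (by positivity) (by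
      have := hC.smul_mem_closure (inv_pos.2 hfy).le htm
      rwa [smul_sub, smul_smul, smul_smul, inv_mul_cancel₀ hfy.ne', one_smul,
        inv_mul_eq_div] at this)
    rw [div_mul_eq_mul_div, le_div_iff₀' hfy] at h1
    have h2 : ε * A y ≤ η / 2 := by
      calc ε * A y ≤ ε * (|A y| + 1) := by gcongr; linarith [le_abs_self (A y)]
        _ = η / 2 := by rw [hε]; field_simp
    linarith
  · let y' : C := ⟨(f x + ε) • (y : V), C.smul_mem (by positivity) y.2⟩
    let q' : C := ⟨t • (p + δ • (y : V)), C.smul_mem ht0 hq⟩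
    let z' : C := ⟨(y' : V) + q', C.add_mem y'.2 q'.2⟩
    have h1 : A x ≤ (f y)⁻¹ * A z' := hA x z' _ (inv_pos.2 hfy) (by
      have h2 := add_mem_closure htm
        (hC.smul_mem_closure (mul_nonneg ht hδ0.le) (subset_closure y.2))
      have h3 := hC.smul_mem_closure (inv_pos.2 hfy).le h2
      have h4 : (f y)⁻¹ • ((f x + ε) • (y : V) - f y • (x : V) + t • p + (t * δ) • (y : V)) =
          (f y)⁻¹ • ((f x + ε) • (y : V) + t • (p + δ • (y : V))) - ((f y)⁻¹ * f y) • (x : V) := by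
        module
      rw [h4, inv_mul_cancel₀ hfy.ne', one_smul] at h3
      exact h3)
    have h2 : A z' ≤ A y' + A q' := hsub _ _ _ rfl
    have h3 : A y' ≤ (f x + ε) * A y := hA y' y _ (by positivity)
      (by rw [sub_self]; exact hC.zero_mem_closure)
    have h4 : A q' ≤ η / 2 := by
      refine (hle q').trans ?_
      change f (t • (p + δ • (y : V))) ≤ _
      rw [map_smul, map_add, map_smul, hfp, zero_add, smul_eq_mul, smul_eq_mul]
      calc t * (δ * f y) = δ * (t * f y) := by ring
        _ ≤ δ * (t * f y + 1) := by gcongr; linarith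
        _ = η / 2 := by rw [hδ]; field_simp
    have h5 : ε * A y ≤ η / 2 := by
      calc ε * A y ≤ ε * (|A y| + 1) := by gcongr; linarith [le_abs_self (A y)]
        _ = η / 2 := by rw [hε]; field_simp
    rw [inv_mul_eq_div, le_div_iff₀' hfy] at h1
    linarith

/-- An antihomogeneous nonnegative function dominated by a linear functional vanishes. -/
lemma IsProperOpen.eq_zero_of_isOrderAntihomogeneous_of_le (hC : C.IsProperOpen) {f : V →L[ℝ] ℝ}
    {B : C → ℝ} (hB : IsOrderAntihomogeneous B) (hB0 : ∀ x, 0 ≤ B x) (hle : ∀ x, B x ≤ f x)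
    (x : C) : B x = 0 := by
  refine le_antisymm (le_of_forall_pos_le_add fun η hη => ?_) (hB0 x)
  have hfx : 0 < f x + 1 := by linarith [hB0 x, hle x]
  -- The degrees -1 and 1 clash: B x ≤ s B(s x) ≤ s² f x, and s is taken small.
  obtain ⟨s, hs, hsη⟩ : ∃ s : ℝ, 0 < s ∧ s * s * (f x + 1) = η :=
    ⟨√(η / (f x + 1)), by positivity, by
      rw [Real.mul_self_sqrt (by positivity)]; field_simp⟩
  have h1 := hB ⟨s • (x : V), C.smul_mem hs x.2⟩ x s hs
    (by rw [sub_self]; exact hC.zero_mem_closure)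
  have h2 := hle ⟨s • (x : V), C.smul_mem hs x.2⟩
  rw [map_smul, smul_eq_mul] at h2
  calc B x ≤ s * (s * f x) := h1.trans (by gcongr)
    _ ≤ s * s * (f x + 1) := by nlinarith [mul_pos hs hs]
    _ = 0 + η := by rw [hsη, zero_add]

/-- Smooth functionals are minimal among the limits of distance functions. -/
theorem IsSmoothFunctional.eq_const_mul_of_le (hC : C.IsProperOpen) {f : V →L[ℝ] ℝ}
    (hf : C.IsSmoothFunctional f) {h : C → ℝ} (hh : h ∈ distanceLimits C)
    (hle : ∀ x : C, h x ≤ f x) : ∃ a : ℝ, 0 ≤ a ∧ ∀ x : C, h x = a * f x := by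
  obtain ⟨A, B, hAB, hA, hsub, hA0, hB, hB0, -⟩ := hC.exists_max_of_mem_distanceLimits hh
  have hAf : ∀ x : C, A x ≤ f x := fun x => by
    have := hle x; rw [hAB] at this; exact (le_max_left _ _).trans this
  have hBf : ∀ x : C, B x ≤ f x := fun x => by
    have := hle x; rw [hAB] at this; exact (le_max_right _ _).trans this
  obtain ⟨e, he⟩ := hC.nonempty
  have hfe := hf.pos e he
  refine ⟨A ⟨e, he⟩ / f e, div_nonneg (hA0 _) hfe.le, fun x => ?_⟩
  rw [hAB, hC.eq_zero_of_isOrderAntihomogeneous_of_le hB hB0 hBf, max_eq_left (hA0 x)]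
  have h1 := hf.mul_le_mul_of_le hC hA hsub hAf x ⟨e, he⟩
  have h2 := hf.mul_le_mul_of_le hC hA hsub hAf ⟨e, he⟩ x
  rw [div_mul_eq_mul_div, eq_div_iff hfe.ne']
  linarith

end DistanceFunctions

/-! ### Pulling smooth functionals back by an isometry -/

section Isometry

variable {V V' : Type*} [NormedAddCommGroup V] [NormedSpace ℝ V]
  [NormedAddCommGroup V'] [NormedSpace ℝ V'] {C : ConvexCone ℝ V} {C' : ConvexCone ℝ V'}

/-- `φ` preserves the exponential of Thompson's metric. -/
def PreservesMaxGauge (φ : C → C') : Prop :=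
  ∀ x y : C, max (C'.coneGauge (φ x) (φ y)) (C'.coneGauge (φ y) (φ x)) =
    max (C.coneGauge x y) (C.coneGauge y x)

lemma PreservesMaxGauge.symm {φ : C ≃ C'} (hφ : PreservesMaxGauge φ) :
    PreservesMaxGauge φ.symm := fun x y => by
  have := hφ (φ.symm x) (φ.symm y)
  rw [φ.apply_symm_apply, φ.apply_symm_apply] at this
  exact this.symm

lemma PreservesMaxGauge.comp_mem_distanceLimits {φ : C ≃ C'} (hφ : PreservesMaxGauge φ)
    {h : C' → ℝ} (hh : h ∈ distanceLimits C') : (fun x => h (φ x)) ∈ distanceLimits C := by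
  refine map_mem_closure (f := fun (h : C' → ℝ) (x : C) => h (φ x)) (by fun_prop) hh ?_
  rintro _ ⟨w, c, hc, rfl⟩
  refine ⟨φ.symm w, c, hc, funext fun x => ?_⟩
  have := hφ x (φ.symm w)
  rw [φ.apply_symm_apply] at this
  exact congrArg (c * ·) this

/-- An isometry pulls a smooth functional back to a homogeneous or an antihomogeneous function. -/
theorem PreservesMaxGauge.comp_smooth_functional (hC : C.IsProperOpen) (hC' : C'.IsProperOpen)
    {φ : C ≃ C'} (hφ : PreservesMaxGauge φ) {f : V' →L[ℝ] ℝ} (hf : C'.IsSmoothFunctional f) :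
    IsOrderHomogeneous (fun x => f (φ x)) ∨ IsOrderAntihomogeneous (fun x => f (φ x)) := by
  obtain ⟨A, B, hAB, hA, -, hA0, hB, hB0, hBlim⟩ :=
    hC.exists_max_of_mem_distanceLimits (hφ.comp_mem_distanceLimits (hf.mem_distanceLimits hC'))
  -- B is itself a limit; transported to `C'` it lies below f, so minimality applies. If a = 0 only
  -- A remains, otherwise f ∘ φ is B / a.
  obtain ⟨a, ha, hBa⟩ := hf.eq_const_mul_of_le hC' (hφ.symm.comp_mem_distanceLimits hBlim)
    fun y => by
      have := hAB (φ.symm y)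
      rw [φ.apply_symm_apply] at this
      rw [this]; exact le_max_right _ _
  have hBφ : ∀ x, B x = a * f (φ x) := fun x => by
    have := hBa (φ x)
    rwa [φ.symm_apply_apply] at this
  rcases ha.eq_or_lt with rfl | ha
  · left
    have : (fun x => f (φ x)) = A := funext fun x => by
      rw [hAB x, hBφ, zero_mul, max_eq_left (hA0 x)]
    rwa [this]
  · right
    have : (fun x => f (φ x)) = fun x => a⁻¹ * B x := funext fun x => by
      rw [hBφ, ← mul_assoc, inv_mul_cancel₀ ha.ne', one_mul]
    rw [this]
    exact hB.const_mul (inv_pos.2 ha).le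

end Isometry

/-! ### Cones split along two subspaces -/

section Splitting

variable {V : Type*} [NormedAddCommGroup V] [NormedSpace ℝ V] {C : ConvexCone ℝ V}
  {W₁ W₂ : Submodule ℝ V}

/-- The cone `C` decomposes along the subspaces `W₁` and `W₂`. -/
structure IsSplitting (C : ConvexCone ℝ V) (W₁ W₂ : Submodule ℝ V) : Prop where
  inf_eq_bot : W₁ ⊓ W₂ = ⊥
  exists_add : ∀ x ∈ C, ∃ x₁ ∈ W₁, ∃ x₂ ∈ W₂, x = x₁ + x₂
  mem_closure : ∀ x₁ ∈ W₁, ∀ x₂ ∈ W₂, x₁ + x₂ ∈ closure (C : Set V) →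
    x₁ ∈ closure (C : Set V) ∧ x₂ ∈ closure (C : Set V)

lemma IsSplitting.symm (h : IsSplitting C W₁ W₂) : IsSplitting C W₂ W₁ where
  inf_eq_bot := by rw [inf_comm]; exact h.inf_eq_bot
  exists_add x hx := by
    obtain ⟨x₁, h₁, x₂, h₂, hx⟩ := h.exists_add x hx
    exact ⟨x₂, h₂, x₁, h₁, hx.trans (add_comm _ _)⟩
  mem_closure x₂ h₂ x₁ h₁ hx := (h.mem_closure x₁ h₁ x₂ h₂ (by rwa [add_comm])).symm

/-- The projection of `C` to `W₁` along `W₂`. -/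
def splitFactor (C : ConvexCone ℝ V) (W₁ W₂ : Submodule ℝ V) : ConvexCone ℝ V where
  carrier := {v | v ∈ W₁ ∧ ∃ u ∈ W₂, v + u ∈ C}
  smul_mem' t ht v := fun ⟨hv, u, hu, hvu⟩ =>
    ⟨W₁.smul_mem t hv, t • u, W₂.smul_mem t hu, smul_add t v u ▸ C.smul_mem ht hvu⟩
  add_mem' v := fun ⟨hv, u, hu, hvu⟩ v' ⟨hv', u', hu', hvu'⟩ =>
    ⟨W₁.add_mem hv hv', u + u', W₂.add_mem hu hu',
      add_add_add_comm v v' u u' ▸ C.add_mem hvu hvu'⟩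

/-- With x₁ + u₂ and x₂ + u₁ in `C`, openness gives s > 0 with x₁ - s u₁ in the closure. Then x₁ +
x₂ is min(s, 1) (x₂ + u₁) plus an element of the closure. -/
lemma IsSplitting.add_mem (hC : IsOpen (C : Set V)) (h : IsSplitting C W₁ W₂) {x₁ x₂ : V}
    (h₁ : x₁ ∈ splitFactor C W₁ W₂) (h₂ : x₂ ∈ splitFactor C W₂ W₁) : x₁ + x₂ ∈ C := by
  obtain ⟨hx₁, u₂, hu₂, hxu⟩ := h₁
  obtain ⟨hx₂, u₁, hu₁, hux⟩ := h₂
  obtain ⟨s, hs, hse⟩ := exists_sub_smul_mem hC hxu (x₂ + u₁)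
  have hy₁ := (h.mem_closure (x₁ - s • u₁) (W₁.sub_mem hx₁ (W₁.smul_mem s hu₁)) (u₂ - s • x₂)
    (W₂.sub_mem hu₂ (W₂.smul_mem s hx₂)) (by
      have : x₁ - s • u₁ + (u₂ - s • x₂) = x₁ + u₂ - s • (x₂ + u₁) := by module
      rw [this]; exact subset_closure hse)).1
  obtain ⟨hu₁K, hx₂K⟩ :=
    h.mem_closure u₁ hu₁ x₂ hx₂ (by rw [add_comm]; exact subset_closure hux)
  rcases lt_trichotomy s 1 with h1 | rfl | h1
  · have := add_mem_of_mem_closure hC (C.smul_mem hs hux)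
      (add_mem_closure hy₁ (C.closure.smul_mem (sub_pos.2 h1) hx₂K))
    have h2 : x₁ + x₂ = s • (x₂ + u₁) + (x₁ - s • u₁ + (1 - s) • x₂) := by module
    rwa [h2]
  · have := add_mem_of_mem_closure hC hux hy₁
    have h2 : x₁ + x₂ = x₂ + u₁ + (x₁ - (1 : ℝ) • u₁) := by module
    rwa [h2]
  · have := add_mem_of_mem_closure hC hux
      (add_mem_closure hy₁ (C.closure.smul_mem (sub_pos.2 h1) hu₁K))
    have h2 : x₁ + x₂ = x₂ + u₁ + (x₁ - s • u₁ + (s - 1) • u₁) := by module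
    rwa [h2]

lemma IsSplitting.exists_add_splitFactor (h : IsSplitting C W₁ W₂) {x : V} (hx : x ∈ C) :
    ∃ x₁ ∈ splitFactor C W₁ W₂, ∃ x₂ ∈ splitFactor C W₂ W₁, x = x₁ + x₂ := by
  obtain ⟨x₁, h₁, x₂, h₂, rfl⟩ := h.exists_add x hx
  exact ⟨x₁, ⟨h₁, x₂, h₂, hx⟩, x₂, ⟨h₂, x₁, h₁, by rwa [add_comm]⟩, rfl⟩

lemma IsSplitting.isDirectProduct (hC : C.IsProperOpen) (h : IsSplitting C W₁ W₂) :
    C.IsDirectProduct (splitFactor C W₁ W₂) (splitFactor C W₂ W₁) := by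
  obtain ⟨e, he⟩ := hC.nonempty
  obtain ⟨e₁, h₁, e₂, h₂, -⟩ := h.exists_add_splitFactor he
  refine ⟨⟨e₁, h₁⟩, ⟨e₂, h₂⟩, ?_, ?_⟩
  · ext x
    constructor
    · intro hx
      obtain ⟨x₁, h₁, x₂, h₂, rfl⟩ := h.exists_add_splitFactor hx
      exact Set.add_mem_add h₁ h₂
    · rintro ⟨x₁, h₁, x₂, h₂, rfl⟩
      exact h.add_mem hC.isOpen h₁ h₂
  · rw [eq_bot_iff, ← h.inf_eq_bot]
    exact inf_le_inf (Submodule.span_le.2 fun x hx => hx.1) (Submodule.span_le.2 fun x hx => hx.1)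

/-- A point v of W₁ in the closure of `C` is approached by v + s e₁, which s e₂ completes to a point
of `C`. -/
lemma IsSplitting.mem_closure_splitFactor (hC : C.IsProperOpen) (h : IsSplitting C W₁ W₂) {v : V}
    (hv : v ∈ W₁) : v ∈ closure (splitFactor C W₁ W₂ : Set V) ↔ v ∈ closure (C : Set V) := by
  constructor
  · refine fun hv => closure_minimal (fun x hx => ?_) isClosed_closure hv
    obtain ⟨hx, u, hu, hxu⟩ := hx
    exact (h.mem_closure x hx u hu (subset_closure hxu)).1
  · intro hvK
    obtain ⟨e, he⟩ := hC.nonempty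
    obtain ⟨e₁, h₁, e₂, h₂, rfl⟩ := h.exists_add e he
    have hlim : Tendsto (fun s : ℝ => v + s • e₁) (𝓝[>] 0) (𝓝 (v + (0 : ℝ) • e₁)) :=
      (Continuous.tendsto (by fun_prop) 0).mono_left nhdsWithin_le_nhds
    rw [zero_smul, add_zero] at hlim
    refine mem_closure_of_tendsto hlim (eventually_nhdsWithin_of_forall fun s hs => ?_)
    refine ⟨W₁.add_mem hv (W₁.smul_mem s h₁), s • e₂, W₂.smul_mem s h₂, ?_⟩
    have := add_mem_of_mem_closure hC.isOpen (C.smul_mem hs he) hvK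
    have h2 : v + s • e₁ + s • e₂ = s • (e₁ + e₂) + v := by module
    rwa [h2]

lemma IsSplitting.exists_sub_smul_mem_closure (hC : IsOpen (C : Set V))
    (h : IsSplitting C W₁ W₂) {x₁ x₂ y₁ y₂ : V} (hx₁ : x₁ ∈ W₁) (hx₂ : x₂ ∈ W₂) (hy₁ : y₁ ∈ W₁)
    (hy₂ : y₂ ∈ W₂) (hy : y₁ + y₂ ∈ C) : ∃ s : ℝ, 0 < s ∧
      y₁ - s • x₁ ∈ closure (C : Set V) ∧ y₂ - s • x₂ ∈ closure (C : Set V) := by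
  obtain ⟨s, hs, hm⟩ := exists_sub_smul_mem hC hy (x₁ + x₂)
  refine ⟨s, hs, h.mem_closure _ (W₁.sub_mem hy₁ (W₁.smul_mem s hx₁)) _
    (W₂.sub_mem hy₂ (W₂.smul_mem s hx₂)) ?_⟩
  have : y₁ - s • x₁ + (y₂ - s • x₂) = y₁ + y₂ - s • (x₁ + x₂) := by module
  rw [this]; exact subset_closure hm

lemma IsSplitting.coneGauge_splitFactor (hC : C.IsProperOpen) (h : IsSplitting C W₁ W₂) {x y : V}
    (hx : x ∈ W₁) (hy : y ∈ W₁) :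
    (splitFactor C W₁ W₂).coneGauge x y = C.coneGauge x y := by
  unfold coneGauge coneLE
  congr 1
  ext t
  exact and_congr_right fun _ =>
    h.mem_closure_splitFactor hC (W₁.sub_mem (W₁.smul_mem t hy) hx)

end Splitting

/-! ### The splitting defined by an isometry -/

section Decomposition

variable {V V' : Type*} [NormedAddCommGroup V] [NormedSpace ℝ V]
  [NormedAddCommGroup V'] [NormedSpace ℝ V'] {C : ConvexCone ℝ V} {C' : ConvexCone ℝ V'}

/-- The common kernel of the smooth functionals that `φ` pulls back to antihomogeneous functions. -/
def preservedSubspace (φ : C → C') : Submodule ℝ V' :=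
  ⨅ f : {f : V' →L[ℝ] ℝ // C'.IsSmoothFunctional f ∧ IsOrderAntihomogeneous fun x => f (φ x)},
    LinearMap.ker (f.1 : V' →ₗ[ℝ] ℝ)

/-- The common kernel of the smooth functionals that `φ` pulls back to homogeneous functions. -/
def reversedSubspace (φ : C → C') : Submodule ℝ V' :=
  ⨅ f : {f : V' →L[ℝ] ℝ // C'.IsSmoothFunctional f ∧ IsOrderHomogeneous fun x => f (φ x)},
    LinearMap.ker (f.1 : V' →ₗ[ℝ] ℝ)

lemma mem_preservedSubspace {φ : C → C'} {v : V'} : v ∈ preservedSubspace φ ↔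
    ∀ f, C'.IsSmoothFunctional f → IsOrderAntihomogeneous (fun x => f (φ x)) → f v = 0 := by
  simp [preservedSubspace, Submodule.mem_iInf]

lemma mem_reversedSubspace {φ : C → C'} {v : V'} : v ∈ reversedSubspace φ ↔
    ∀ f, C'.IsSmoothFunctional f → IsOrderHomogeneous (fun x => f (φ x)) → f v = 0 := by
  simp [reversedSubspace, Submodule.mem_iInf]

lemma IsOrderHomogeneous.map_smul (hC : C.IsProperOpen) {h : C → ℝ} (hh : IsOrderHomogeneous h)
    {x y : C} {t : ℝ} (ht : 0 < t) (hy : (y : V) = t • (x : V)) : h y = t * h x := by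
  have h1 := hh y x t ht (by rw [hy, sub_self]; exact hC.zero_mem_closure)
  have h2 := hh x y t⁻¹ (inv_pos.2 ht) (by
    rw [hy, smul_smul, inv_mul_cancel₀ ht.ne', one_smul, sub_self]; exact hC.zero_mem_closure)
  rw [inv_mul_eq_div, le_div_iff₀' ht] at h2
  exact le_antisymm h1 h2

lemma IsOrderAntihomogeneous.map_smul (hC : C.IsProperOpen) {h : C → ℝ}
    (hh : IsOrderAntihomogeneous h) {x y : C} {t : ℝ} (ht : 0 < t) (hy : (y : V) = t • (x : V)) :
    h y = t⁻¹ * h x := by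
  have h1 := hh y x t ht (by rw [hy, sub_self]; exact hC.zero_mem_closure)
  have h2 := hh x y t⁻¹ (inv_pos.2 ht) (by
    rw [hy, smul_smul, inv_mul_cancel₀ ht.ne', one_smul, sub_self]; exact hC.zero_mem_closure)
  refine le_antisymm h2 ?_
  rwa [inv_mul_eq_div, div_le_iff₀' ht]

variable [FiniteDimensional ℝ V'] {φ : C ≃ C'}

/-- Multiplication by `t` is conjugated to multiplication by `t` on the preserved part and by
`t⁻¹` on the reversed part. -/
lemma PreservesMaxGauge.map_smul (hφ : PreservesMaxGauge φ) (hC : C.IsProperOpen)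
    (hC' : C'.IsProperOpen) {x z : C} {t : ℝ} (ht : 0 < t) (hz : (z : V) = t • (x : V)) {y₁ y₂ : V'}
    (h₁ : y₁ ∈ preservedSubspace φ) (h₂ : y₂ ∈ reversedSubspace φ)
    (hy : (φ x : V') = y₁ + y₂) : (φ z : V') = t • y₁ + t⁻¹ • y₂ := by
  rw [mem_preservedSubspace] at h₁
  rw [mem_reversedSubspace] at h₂
  rw [← sub_eq_zero]
  refine hC'.eq_zero_of_smooth fun f hf => ?_
  rw [map_sub, map_add, _root_.map_smul, _root_.map_smul, smul_eq_mul, smul_eq_mul]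
  have hy' := congrArg f hy
  rw [map_add] at hy'
  rcases hφ.comp_smooth_functional hC hC' hf with h | h
  · rw [h.map_smul hC ht hz, hy', h₂ f hf h]; ring
  · rw [h.map_smul hC ht hz, hy', h₁ f hf h]; ring

/-- Every smooth functional kills one of the two components, so its sign on the sum is its sign on
the other. -/
lemma PreservesMaxGauge.isSplitting (hφ : PreservesMaxGauge φ) (hC : C.IsProperOpen)
    (hC' : C'.IsProperOpen) : IsSplitting C' (preservedSubspace φ) (reversedSubspace φ) where
  inf_eq_bot := by
    rw [eq_bot_iff]
    rintro v ⟨h₁, h₂⟩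
    rw [SetLike.mem_coe, mem_preservedSubspace] at h₁
    rw [SetLike.mem_coe, mem_reversedSubspace] at h₂
    exact (Submodule.mem_bot ℝ).2 (hC'.eq_zero_of_smooth fun f hf =>
      (hφ.comp_smooth_functional hC hC' hf).elim (h₂ f hf) (h₁ f hf))
  exists_add y hy := by
    obtain ⟨x, hx⟩ := φ.surjective ⟨y, hy⟩
    have hy' : y = φ x := by rw [hx]
    let z : C := ⟨(2 : ℝ) • (x : V), C.smul_mem two_pos x.2⟩
    -- Expecting φ x = y₁ + y₂ and φ(2x) = 2 y₁ + y₂ / 2, these are the solutions for y₁ and y₂.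
    refine ⟨(2 / 3 : ℝ) • ((φ z : V') - (1 / 2 : ℝ) • (φ x : V')), ?_,
      (2 / 3 : ℝ) • ((2 : ℝ) • (φ x : V') - φ z), ?_, ?_⟩
    · rw [mem_preservedSubspace]
      intro f hf h
      have := h.map_smul hC (x := x) (y := z) two_pos rfl
      simp only [_root_.map_smul, map_sub, smul_eq_mul, this]
      ring
    · rw [mem_reversedSubspace]
      intro f hf h
      have := h.map_smul hC (x := x) (y := z) two_pos rfl
      simp only [_root_.map_smul, map_sub, smul_eq_mul, this]
      ring
    · rw [hy']; module
  mem_closure y₁ h₁ y₂ h₂ hy := by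
    rw [mem_preservedSubspace] at h₁
    rw [mem_reversedSubspace] at h₂
    rw [hC'.mem_closure_iff_smooth, hC'.mem_closure_iff_smooth]
    have hadd : ∀ f, C'.IsSmoothFunctional f → 0 ≤ f y₁ + f y₂ := fun f hf => by
      rw [← map_add]; exact hf.nonneg hy
    constructor
    · intro f hf
      rcases hφ.comp_smooth_functional hC hC' hf with h | h
      · have := hadd f hf
        rwa [h₂ f hf h, add_zero] at this
      · exact (h₁ f hf h).ge
    · intro f hf
      rcases hφ.comp_smooth_functional hC hC' hf with h | h
      · exact (h₂ f hf h).ge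
      · have := hadd f hf
        rwa [h₁ f hf h, zero_add] at this

variable [FiniteDimensional ℝ V]

/-- On the first components, `φ` is monotone and homogeneous. -/
lemma PreservesMaxGauge.smul_sub_mem_preserved (hφ : PreservesMaxGauge φ) (hC : C.IsProperOpen)
    (hC' : C'.IsProperOpen) {x z : C} {x₁ x₂ z₁ z₂ : V} {y₁ y₂ w₁ w₂ : V'}
    (hx₁ : x₁ ∈ preservedSubspace φ.symm) (hx₂ : x₂ ∈ reversedSubspace φ.symm)
    (hz₁ : z₁ ∈ preservedSubspace φ.symm) (hz₂ : z₂ ∈ reversedSubspace φ.symm)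
    (hy₁ : y₁ ∈ preservedSubspace φ) (hy₂ : y₂ ∈ reversedSubspace φ)
    (hw₁ : w₁ ∈ preservedSubspace φ) (hw₂ : w₂ ∈ reversedSubspace φ)
    (hx : (x : V) = x₁ + x₂) (hz : (z : V) = z₁ + z₂)
    (hy : (φ x : V') = y₁ + y₂) (hw : (φ z : V') = w₁ + w₂) {t : ℝ} (ht : 0 < t)
    (h : t • z₁ - x₁ ∈ closure (C : Set V)) : t • w₁ - y₁ ∈ closure (C' : Set V') := by
  have hsplit := hφ.symm.isSplitting hC' hC
  rw [mem_preservedSubspace] at hy₁ hw₁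
  rw [mem_reversedSubspace] at hy₂ hw₂
  rw [hC'.mem_closure_iff_smooth]
  intro f hf
  rw [map_sub, _root_.map_smul, smul_eq_mul, sub_nonneg]
  rcases hφ.comp_smooth_functional hC hC' hf with hh | hh
  · obtain ⟨s, hs, -, hs₂⟩ :=
      hsplit.exists_sub_smul_mem_closure hC.isOpen hx₁ hx₂ hz₁ hz₂ (hz ▸ z.2)
    -- The choice r⁻¹ = t r s gives r⁻¹ x₂ ≤ t r z₂ for free. With r x₁ ≤ t r z₁, the preimage of r
    -- φ(x) is then at most t r z, and r cancels after applying f ∘ φ.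
    obtain ⟨r, hr, hrs⟩ : ∃ r : ℝ, 0 < r ∧ r * r * (t * s) = 1 :=
      ⟨√(1 / (t * s)), by positivity, by rw [Real.mul_self_sqrt (by positivity)]; field_simp⟩
    let y' : C' := ⟨r • (φ x : V'), C'.smul_mem hr (φ x).2⟩
    have h1 : (φ.symm y' : V) = r • x₁ + r⁻¹ • x₂ :=
      hφ.symm.map_smul hC' hC (x := φ x) hr rfl hx₁ hx₂ (by rw [φ.symm_apply_apply, hx])
    have h2 := hh (φ.symm y') z (t * r) (mul_pos ht hr) (by
      have h3 := add_mem_closure (C.closure.smul_mem hr h)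
        (C.closure.smul_mem (mul_pos ht hr) hs₂)
      have h4 : r⁻¹ = t * r * s := inv_eq_of_mul_eq_one_right (by linarith)
      have h5 : (t * r) • (z : V) - φ.symm y' =
          r • (t • z₁ - x₁) + (t * r) • (z₂ - s • x₂) := by
        rw [h1, hz, h4]; module
      rwa [h5])
    simp only [φ.apply_symm_apply] at h2
    change f (r • (φ x : V')) ≤ _ at h2
    rw [_root_.map_smul, hy, hw, map_add, map_add, hy₂ f hf hh, hw₂ f hf hh, smul_eq_mul,
      add_zero, add_zero, mul_comm t, mul_assoc] at h2
    exact le_of_mul_le_mul_left h2 hr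
  · rw [hy₁ f hf hh, hw₁ f hf hh, mul_zero]

/-- On the second components, `φ` is antitone and homogeneous of degree `-1`. -/
lemma PreservesMaxGauge.smul_sub_mem_reversed (hφ : PreservesMaxGauge φ) (hC : C.IsProperOpen)
    (hC' : C'.IsProperOpen) {x z : C} {x₁ x₂ z₁ z₂ : V} {y₁ y₂ w₁ w₂ : V'}
    (hx₁ : x₁ ∈ preservedSubspace φ.symm) (hx₂ : x₂ ∈ reversedSubspace φ.symm)
    (hz₁ : z₁ ∈ preservedSubspace φ.symm) (hz₂ : z₂ ∈ reversedSubspace φ.symm)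
    (hy₁ : y₁ ∈ preservedSubspace φ) (hy₂ : y₂ ∈ reversedSubspace φ)
    (hw₁ : w₁ ∈ preservedSubspace φ) (hw₂ : w₂ ∈ reversedSubspace φ)
    (hx : (x : V) = x₁ + x₂) (hz : (z : V) = z₁ + z₂)
    (hy : (φ x : V') = y₁ + y₂) (hw : (φ z : V') = w₁ + w₂) {t : ℝ} (ht : 0 < t)
    (h : t • z₂ - x₂ ∈ closure (C : Set V)) : t • y₂ - w₂ ∈ closure (C' : Set V') := by
  have hsplit := hφ.symm.isSplitting hC' hC
  rw [mem_preservedSubspace] at hy₁ hw₁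
  rw [mem_reversedSubspace] at hy₂ hw₂
  rw [hC'.mem_closure_iff_smooth]
  intro f hf
  rw [map_sub, _root_.map_smul, smul_eq_mul, sub_nonneg]
  rcases hφ.comp_smooth_functional hC hC' hf with hh | hh
  · rw [hy₂ f hf hh, hw₂ f hf hh, mul_zero]
  · obtain ⟨s, hs, hs₁, -⟩ :=
      hsplit.exists_sub_smul_mem_closure hC.isOpen hx₁ hx₂ hz₁ hz₂ (hz ▸ z.2)
    -- Now r = t r⁻¹ s makes the first component automatic: r x₁ ≤ t r⁻¹ z₁.
    obtain ⟨r, hr, hrs⟩ : ∃ r : ℝ, 0 < r ∧ r * r = t * s :=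
      ⟨√(t * s), by positivity, Real.mul_self_sqrt (by positivity)⟩
    let y' : C' := ⟨r • (φ x : V'), C'.smul_mem hr (φ x).2⟩
    have h1 : (φ.symm y' : V) = r • x₁ + r⁻¹ • x₂ :=
      hφ.symm.map_smul hC' hC (x := φ x) hr rfl hx₁ hx₂ (by rw [φ.symm_apply_apply, hx])
    have h2 := hh (φ.symm y') z (t * r⁻¹) (by positivity) (by
      have h3 := add_mem_closure (C.closure.smul_mem (inv_pos.2 hr) h)
        (C.closure.smul_mem (mul_pos ht (inv_pos.2 hr)) hs₁)
      have h4 : r = t * r⁻¹ * s := by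
        field_simp; linarith
      have h5 : (t * r⁻¹) • (z : V) - φ.symm y' =
          r⁻¹ • (t • z₂ - x₂) + (t * r⁻¹) • (z₁ - s • x₁) := by
        rw [h1, hz]
        conv_lhs => enter [2, 1, 1]; rw [h4]
        module
      rwa [h5])
    simp only [φ.apply_symm_apply] at h2
    change _ ≤ _ * f (r • (φ x : V')) at h2
    rw [_root_.map_smul, hy, hw, map_add, map_add, hy₁ f hf hh, hw₁ f hf hh, smul_eq_mul,
      zero_add, zero_add, mul_assoc, inv_mul_cancel_left₀ hr.ne'] at h2
    exact h2

end Decomposition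

/-! ### From Thompson isometries to gauges, and induced maps on factors -/

section Thompson

variable {V V' : Type*} [NormedAddCommGroup V] [NormedSpace ℝ V]
  [NormedAddCommGroup V'] [NormedSpace ℝ V'] {C : ConvexCone ℝ V} {C' : ConvexCone ℝ V'}

lemma IsProperOpen.subsingleton_of_subsingleton (hC : C.IsProperOpen) [Subsingleton C] :
    Subsingleton V := by
  by_contra hV
  rw [not_subsingleton_iff_nontrivial] at hV
  obtain ⟨e, he⟩ := hC.nonempty
  have h := Subsingleton.elim (⟨e, he⟩ : C) ⟨(2 : ℝ) • e, C.smul_mem two_pos he⟩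
  have h1 : e = (2 : ℝ) • e := congrArg Subtype.val h
  rw [two_smul, left_eq_add] at h1
  exact hC.zero_notMem (h1 ▸ he)

lemma IsProperOpen.coneGauge_self_le (hC : C.IsProperOpen) {x : V} (hx : x ∈ C) :
    C.coneGauge x x ≤ 1 := by
  rw [hC.coneGauge_le_iff hx zero_le_one, one_smul, sub_self]
  exact hC.zero_mem_closure

lemma IsThompsonIsometry.injective (hC : C.IsProperOpen) (hC' : C'.IsProperOpen) {φ : C → C'}
    (hφ : IsThompsonIsometry φ) : Function.Injective φ := by
  intro x y hxy
  rcases subsingleton_or_nontrivial V with hV | hV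
  · exact Subsingleton.elim _ _
  have h1 := hφ x y
  rw [hxy] at h1
  have h2 : C'.thompsonDist (φ y) (φ y) ≤ 0 := by
    rw [thompsonDist, max_self]
    exact Real.log_nonpos (coneGauge_nonneg _ _) (hC'.coneGauge_self_le (φ y).2)
  rw [h1, thompsonDist] at h2
  have h3 := hC.coneGauge_pos x.2 y.2
  rw [Real.log_nonpos_iff (h3.le.trans (le_max_left _ _)), max_le_iff,
    hC.coneGauge_le_iff y.2 zero_le_one, hC.coneGauge_le_iff x.2 zero_le_one, one_smul,
    one_smul] at h2
  exact Subtype.ext (sub_eq_zero.1 (hC.eq_zero_of_neg_mem h2.2 (by rw [neg_sub]; exact h2.1)))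

/-- The logarithm cancels because gauges are positive in a nontrivial space; in the zero space all
gauges vanish. -/
lemma IsThompsonIsometry.preservesMaxGauge (hC : C.IsProperOpen) (hC' : C'.IsProperOpen)
    {φ : C ≃ C'} (hφ : IsThompsonIsometry φ) : PreservesMaxGauge φ := by
  intro x y
  rcases subsingleton_or_nontrivial V with hV | hV
  · have : Subsingleton C' := φ.symm.subsingleton
    have := hC'.subsingleton_of_subsingleton
    have h0 : ∀ u v : C, C.coneGauge u v = 0 := fun u v =>
      le_antisymm ((hC.coneGauge_le_iff v.2 le_rfl).2
        (Subsingleton.mem_iff_nonempty.2 (hC.nonempty.mono subset_closure))) (coneGauge_nonneg _ _)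
    have h0' : ∀ u v : C', C'.coneGauge u v = 0 := fun u v =>
      le_antisymm ((hC'.coneGauge_le_iff v.2 le_rfl).2
        (Subsingleton.mem_iff_nonempty.2 (hC'.nonempty.mono subset_closure))) (coneGauge_nonneg _ _)
    rw [h0, h0, h0', h0']
  · have : Nontrivial V' := by
      by_contra hV'
      rw [not_nontrivial_iff_subsingleton] at hV'
      have : Subsingleton C := φ.subsingleton
      exact not_subsingleton V hC.subsingleton_of_subsingleton
    exact Real.log_injOn_pos ((hC'.coneGauge_pos (φ x).2 (φ y).2).trans_le (le_max_left _ _))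
      ((hC.coneGauge_pos x.2 y.2).trans_le (le_max_left _ _)) (hφ x y)

/-- A map that is compatible with two splittings induces a map on the first factors. -/
lemma exists_map_splitFactor {W₁ W₂ : Submodule ℝ V} {W₁' W₂' : Submodule ℝ V'}
    (hC' : C'.IsProperOpen) (h' : IsSplitting C' W₁' W₂') {φ : C → C'}
    (hφ : ∀ (x z : C), ∀ x₁ ∈ W₁, ∀ x₂ ∈ W₂, ∀ z₂ ∈ W₂, ∀ y₁ ∈ W₁', ∀ y₂ ∈ W₂',
      ∀ w₁ ∈ W₁', ∀ w₂ ∈ W₂', (x : V) = x₁ + x₂ → (z : V) = x₁ + z₂ → (φ x : V') = y₁ + y₂ →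
      (φ z : V') = w₁ + w₂ → w₁ - y₁ ∈ closure (C' : Set V')) :
    ∃ φ₁ : splitFactor C W₁ W₂ → splitFactor C' W₁' W₂', ∀ (x : C) (x₁ : splitFactor C W₁ W₂),
      ∀ x₂ ∈ W₂, ∀ y₁ ∈ W₁', ∀ y₂ ∈ W₂', (x : V) = x₁ + x₂ → (φ x : V') = y₁ + y₂ →
      (φ₁ x₁ : V') = y₁ := by
  have hex : ∀ x₁ : splitFactor C W₁ W₂, ∃ (x : C) (y₁ : splitFactor C' W₁' W₂'),
      ∃ x₂ ∈ W₂, ∃ y₂ ∈ W₂', (x : V) = x₁ + x₂ ∧ (φ x : V') = y₁ + y₂ := by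
    rintro ⟨x₁, hx₁, x₂, hx₂, hx⟩
    obtain ⟨y₁, hy₁, y₂, hy₂, hy⟩ := h'.exists_add_splitFactor (φ ⟨x₁ + x₂, hx⟩).2
    exact ⟨⟨x₁ + x₂, hx⟩, ⟨y₁, hy₁⟩, x₂, hx₂, y₂, hy₂.1, rfl, hy⟩
  choose X φ₁ X₂ hX₂ Y₂ hY₂ hX hY using hex
  refine ⟨φ₁, fun x x₁ x₂ hx₂ y₁ hy₁ y₂ hy₂ hx hy => ?_⟩
  -- Comparing x with the chosen lift of x₁ in both directions, pointedness of the cone shows that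
  -- the first component of φ x depends on x₁ alone.
  have h1 := hφ x (X x₁) x₁ x₁.2.1 x₂ hx₂ _ (hX₂ x₁) y₁ hy₁ y₂ hy₂ _ (φ₁ x₁).2.1 _ (hY₂ x₁) hx
    (hX x₁) hy (hY x₁)
  have h2 := hφ (X x₁) x x₁ x₁.2.1 _ (hX₂ x₁) x₂ hx₂ _ (φ₁ x₁).2.1 _ (hY₂ x₁) y₁ hy₁ y₂ hy₂ (hX x₁)
    hx (hY x₁) hy
  exact sub_eq_zero.1 (hC'.eq_zero_of_neg_mem h1 (by rwa [neg_sub]))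

end Thompson

end ConvexCone

/-! ### Assembly of the two factor maps -/

theorem mainTheorem4 {V V' : Type*}
    [NormedAddCommGroup V] [NormedSpace ℝ V] [FiniteDimensional ℝ V]
    [NormedAddCommGroup V'] [NormedSpace ℝ V'] [FiniteDimensional ℝ V']
    (C : ConvexCone ℝ V) (C' : ConvexCone ℝ V')
    (hC : C.IsProperOpen) (hC' : C'.IsProperOpen)
    (φ : C → C') (hsurj : Function.Surjective φ) (hiso : ConvexCone.IsThompsonIsometry φ) :
    ∃ (C₁ C₂ : ConvexCone ℝ V) (C₁' C₂' : ConvexCone ℝ V'),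
      C.IsDirectProduct C₁ C₂ ∧ C'.IsDirectProduct C₁' C₂' ∧
      ∃ (φ₁ : C₁ → C₁') (φ₂ : C₂ → C₂'),
        ConvexCone.IsGaugePreserving φ₁ ∧ ConvexCone.IsGaugeReversing φ₂ ∧
        ∀ (x : C) (x₁ : C₁) (x₂ : C₂), (x : V) = (x₁ : V) + (x₂ : V) →
          (φ x : V') = (φ₁ x₁ : V') + (φ₂ x₂ : V') := by
  obtain ⟨ψ, rfl⟩ : ∃ ψ : C ≃ C', φ = ψ :=
    ⟨Equiv.ofBijective φ ⟨hiso.injective hC hC', hsurj⟩, rfl⟩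
  have hψ := hiso.preservesMaxGauge hC hC'
  have hs := hψ.symm.isSplitting hC' hC
  have hs' := hψ.isSplitting hC hC'
  obtain ⟨φ₁, hφ₁⟩ := ConvexCone.exists_map_splitFactor (C := C) (φ := ψ)
    (W₁ := ConvexCone.preservedSubspace ψ.symm) (W₂ := ConvexCone.reversedSubspace ψ.symm) hC' hs'
    fun x z x₁ hx₁ x₂ hx₂ z₂ hz₂ y₁ hy₁ y₂ hy₂ w₁ hw₁ w₂ hw₂ hx hz hy hw => by
      have := hψ.smul_sub_mem_preserved hC hC' hx₁ hx₂ hx₁ hz₂ hy₁ hy₂ hw₁ hw₂ hx hz hy hw one_pos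
        (by rw [one_smul, sub_self]; exact hC.zero_mem_closure)
      rwa [one_smul] at this
  obtain ⟨φ₂, hφ₂⟩ := ConvexCone.exists_map_splitFactor (C := C) (φ := ψ)
    (W₁ := ConvexCone.reversedSubspace ψ.symm) (W₂ := ConvexCone.preservedSubspace ψ.symm) hC'
    hs'.symm
    fun x z x₂ hx₂ x₁ hx₁ z₁ hz₁ y₂ hy₂ y₁ hy₁ w₂ hw₂ w₁ hw₁ hx hz hy hw => by
      rw [add_comm] at hx hz hy hw
      -- The two points are exchanged because the order is reversed on this factor.
      have := hψ.smul_sub_mem_reversed hC hC' hz₁ hx₂ hx₁ hx₂ hw₁ hw₂ hy₁ hy₂ hz hx hw hy one_pos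
        (by rw [one_smul, sub_self]; exact hC.zero_mem_closure)
      rwa [one_smul] at this
  have hφ : ∀ (x : C) (x₁ : ConvexCone.splitFactor C (ConvexCone.preservedSubspace ψ.symm)
      (ConvexCone.reversedSubspace ψ.symm))
      (x₂ : ConvexCone.splitFactor C (ConvexCone.reversedSubspace ψ.symm)
        (ConvexCone.preservedSubspace ψ.symm)), (x : V) = (x₁ : V) + (x₂ : V) →
          (ψ x : V') = (φ₁ x₁ : V') + (φ₂ x₂ : V') := fun x x₁ x₂ hx => by
    obtain ⟨y₁, hy₁, y₂, hy₂, hy⟩ := hs'.exists_add _ (ψ x).2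
    rw [hφ₁ x x₁ x₂ x₂.2.1 y₁ hy₁ y₂ hy₂ hx hy,
      hφ₂ x x₂ x₁ x₁.2.1 y₂ hy₂ y₁ hy₁ (hx.trans (add_comm _ _)) (hy.trans (add_comm _ _)), hy]
  obtain ⟨⟨e₁, he₁⟩, ⟨e₂, he₂⟩, -, -⟩ := hs.isDirectProduct hC
  refine ⟨_, _, _, _, hs.isDirectProduct hC, hs'.isDirectProduct hC', φ₁, φ₂, fun x₁ z₁ => ?_,
    fun x₂ z₂ => ?_, hφ⟩
  -- A fixed e₂ completes points of the first factor to points of `C`; ψ and its inverse give the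
  -- two inclusions between the sets defining the gauges.
  · let x : C := ⟨_, hs.add_mem hC.isOpen x₁.2 he₂⟩
    let z : C := ⟨_, hs.add_mem hC.isOpen z₁.2 he₂⟩
    have hy := hφ x x₁ ⟨e₂, he₂⟩ rfl
    have hw := hφ z z₁ ⟨e₂, he₂⟩ rfl
    rw [hs.coneGauge_splitFactor hC x₁.2.1 z₁.2.1,
      hs'.coneGauge_splitFactor hC' (φ₁ x₁).2.1 (φ₁ z₁).2.1]
    unfold ConvexCone.coneGauge ConvexCone.coneLE
    congr 1
    ext t
    refine and_congr_right fun ht => ⟨fun h => ?_, fun h => ?_⟩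
    · exact hψ.symm.smul_sub_mem_preserved hC' hC (x := ψ x) (z := ψ z) (φ₁ x₁).2.1
        (φ₂ ⟨e₂, he₂⟩).2.1 (φ₁ z₁).2.1 (φ₂ ⟨e₂, he₂⟩).2.1 x₁.2.1 he₂.1 z₁.2.1 he₂.1 hy hw
        (by rw [ψ.symm_apply_apply]) (by rw [ψ.symm_apply_apply]) ht h
    · exact hψ.smul_sub_mem_preserved hC hC' (x := x) (z := z) x₁.2.1 he₂.1 z₁.2.1 he₂.1
        (φ₁ x₁).2.1 (φ₂ ⟨e₂, he₂⟩).2.1 (φ₁ z₁).2.1 (φ₂ ⟨e₂, he₂⟩).2.1 rfl rfl hy hw ht h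
  · let x : C := ⟨_, hs.add_mem hC.isOpen he₁ x₂.2⟩
    let z : C := ⟨_, hs.add_mem hC.isOpen he₁ z₂.2⟩
    have hy := hφ x ⟨e₁, he₁⟩ x₂ rfl
    have hw := hφ z ⟨e₁, he₁⟩ z₂ rfl
    rw [hs.symm.coneGauge_splitFactor hC z₂.2.1 x₂.2.1,
      hs'.symm.coneGauge_splitFactor hC' (φ₂ x₂).2.1 (φ₂ z₂).2.1]
    unfold ConvexCone.coneGauge ConvexCone.coneLE
    congr 1
    ext t
    refine and_congr_right fun ht => ⟨fun h => ?_, fun h => ?_⟩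
    · exact hψ.symm.smul_sub_mem_reversed hC' hC (x := ψ x) (z := ψ z) (φ₁ ⟨e₁, he₁⟩).2.1
        (φ₂ x₂).2.1 (φ₁ ⟨e₁, he₁⟩).2.1 (φ₂ z₂).2.1 he₁.1 x₂.2.1 he₁.1 z₂.2.1 hy hw
        (by rw [ψ.symm_apply_apply]) (by rw [ψ.symm_apply_apply]) ht h
    · exact hψ.smul_sub_mem_reversed hC hC' (x := z) (z := x) he₁.1 z₂.2.1 he₁.1 x₂.2.1
        (φ₁ ⟨e₁, he₁⟩).2.1 (φ₂ z₂).2.1 (φ₁ ⟨e₁, he₁⟩).2.1 (φ₂ x₂).2.1 rfl rfl hw hy ht h
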